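/- Let $H$ be a real Hilbert space. Let $F:\operatorname{Dom}F\subset H\to H$ be a single-valued, continuous, monotone map satisfying $\|F(x)-F(y)\|\le L\|x-y\|$ for all $x,y\in\operatorname{Dom}F$, where $L>0$. Let $B:H\rightrightarrows H$ be maximal monotone with $\operatorname{Dom}B\subset C\subset\operatorname{Dom}F$, where $C$ is a nonempty closed convex subset of $H$, and assume that the solution set $S=(F+B)^{-1}(0)=\{x : 0\in F(x)+B(x)\}$ is nonempty. Let $x_0\in H$, $\sigma\in(0,1)$, $\lambda=\sigma/L$, and let $(\alpha_k)_{k\ge0}$, $(\beta_k)_{k\ge0}$ be sequences of nonnegative reals with $$\overline\alpha=\sup_{k\ge0}\alpha_k<\infty,\qquad \overline s=\sum_{k=0}^\infty\beta_k^2<\infty,\qquad \overline\beta=\sup_{k\ge0}\beta_k .$$ Write $P_A$ for the orthogonal projection onto $A$. Put $x_{-1}=x_0$ and, for $k=0,1,2,\dots$, $$w_k=x_k+\alpha_k(x_k-x_{k-1}),\qquad \widetilde w_k=w_k+\beta_k(w_k-x_0),\qquad w_k'=P_C(\widetilde w_k),$$ $$y_k=(\lambda B+I)^{-1}\bigl(\widetilde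 w_k-\lambda F(w_k')\bigr),\qquad v_k=F(y_k)-F(w_k')+\tfrac1\lambda(\widetilde w_k-y_k),$$ $$H_k=\{z:\langle z-y_k,v_k\rangle\le0\},\qquad W_k=\{z:\langle z-x_k,x_0-x_k\rangle\le0\},\qquad x_{k+1}=P_{H_k\cap W_k}(x_0).$$ Then these sequences and the projection $P_S(x_0)$ are well defined and, with $d_0$ denoting the distance from $x_0$ to $S$, the following hold. (a) The sequences $(x_k)$ and $(y_k)$ converge strongly to $P_S(x_0)$. (b) For every $k\ge0$ there exists $j\in\{0,\dots,k\}$ such that $v_j\in(F+B)(y_j)$ and $$\|v_j\|\le\frac{2d_0L}{\sqrt{k+1}}\cdot\frac{\sqrt{(1+\overline\alpha)\left[(1+\overline\beta)\bigl(1+\overline\alpha(1+\overline\beta)\bigr)+\overline s\right]}}{(1-\sigma^2)\,\sigma}.$$ -/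

import Mathlib

namespace InertialTseng

open scoped Pointwise

variable {H : Type*} [NormedAddCommGroup H] [InnerProductSpace ℝ H]

/-- A set-valued map `T : H ⇉ H` is a monotone operator. -/
def IsMonotoneOp (T : H → Set H) : Prop :=
  ∀ x y, ∀ u ∈ T x, ∀ v ∈ T y, 0 ≤ inner ℝ (x - y) (u - v)

/-- `T` is maximal monotone: it is monotone and its graph is not properly contained in the graph
of another monotone operator. -/
def IsMaximalMonotoneOp (T : H → Set H) : Prop :=
  IsMonotoneOp T ∧ ∀ T' : H → Set H, IsMonotoneOp T' → (∀ x, T x ⊆ T' x) → T' = T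

/-- The effective domain of a set-valued map. -/
def opDom (T : H → Set H) : Set H := {x | (T x).Nonempty}

/-- The inverse of a set-valued map. -/
def opInv (T : H → Set H) : H → Set H := fun x => {v | x ∈ T v}

/-- The set-valued representation of a single-valued map `F : D ⊆ H → H` (the values of `F`
outside `D` are irrelevant). -/
def ofMap (F : H → H) (D : Set H) : H → Set H := fun x => {u | x ∈ D ∧ u = F x}

/-- The Minkowski sum of two set-valued maps. -/
def opAdd (T S : H → Set H) : H → Set H := fun x => T x + S x

/-- The resolvent `(lam T + I)⁻¹`, as a set-valued map. -/
def opResolvent (lam : ℝ) (T : H → Set H) : H → Set H :=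
  opInv (opAdd (fun x => lam • T x) (fun x => {x}))

/-- The solution set `(F + B)⁻¹(0)` of the inclusion `0 ∈ F(x) + B(x)`, with `Dom F = D`. -/
def solSet (F : H → H) (D : Set H) (B : H → Set H) : Set H :=
  opInv (opAdd (ofMap F D) B) 0

/-- `p = P_C(x)`: `p` is the unique element of `C` at minimal distance from `x`. -/
def IsProj (C : Set H) (x p : H) : Prop :=
  ∀ q, (q ∈ C ∧ ∀ z ∈ C, ‖q - x‖ ≤ ‖z - x‖) ↔ q = p

/-- The sequences `x, w, wt, w', y, v` are generated by the inertial Tseng forward-backward method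
with stepsize `lam`, inertial parameters `α, β` and starting point `x0`. Here `wt` and `wp` are the
sequences written `w̃` and `w'`. The convention `x₋₁ = x₀` is built into the truncated index
`k - 1`, which is `0` for `k = 0`. -/
structure IsTsengRun (F : H → H) (B : H → Set H) (C : Set H) (lam : ℝ) (α β : ℕ → ℝ) (x0 : H)
    (x w wt wp y v : ℕ → H) : Prop where
  init : x 0 = x0
  w_eq : ∀ k, w k = x k + α k • (x k - x (k - 1))
  wt_eq : ∀ k, wt k = w k + β k • (w k - x0)
  wp_eq : ∀ k, IsProj C (wt k) (wp k)
  y_eq : ∀ k, y k ∈ opResolvent lam B (wt k - lam • F (wp k))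
  v_eq : ∀ k, v k = F (y k) - F (wp k) + (1 / lam) • (wt k - y k)
  x_succ : ∀ k, IsProj
    ({z | inner ℝ (z - y k) (v k) ≤ 0} ∩ {z | inner ℝ (z - x k) (x0 - x k) ≤ 0}) x0 (x (k + 1))

end InertialTseng

open InertialTseng

/-!
Tseng's correction makes `v k` an exact element of `(F + B) (y k)`, so by monotonicity `H_k`
contains the solution set `S`, and by induction so does `W_k`. Hence `P_{W_k}(x0) = x k` gives
`‖x (k + 1) - x0‖² ≥ ‖x k - x0‖² + ‖x (k + 1) - x k‖²` with `‖x k - x0‖ ≤ d₀`: the squared steps are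
summable, and expanding the two inertial terms bounds `∑ ‖w̃ k - x (k + 1)‖²`.

Since `λ L = σ < 1`, `y k` solves the proximal inclusion with relative error
`‖λ v k - (w̃ k - y k)‖ ≤ σ ‖w̃ k - y k‖`, and with `x (k + 1) ∈ H_k` this yields both
`λ ‖v k‖ ≤ 2 ‖w̃ k - x (k + 1)‖` and `(1 - σ²) ‖w̃ k - y k‖² ≤ ‖w̃ k - x (k + 1)‖²`. The first bound
gives the rate; the two together give `v k → 0` and `y k - x k → 0`, so weak cluster points of `x`
lie in `S`, because the graph of a maximal monotone operator is weak-strong closed. Among points of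
`S` only `P_S(x0)` is within `d₀` of `x0`, and the norm bound upgrades weak convergence to strong.

Resolvents of `B` are everywhere defined by Minty's theorem, obtained by minimizing
`φ(x, u) + (‖x‖² + ‖u‖²) / 2` for the Fitzpatrick function `φ` of `B`. By Banach's fixed point
theorem so are the resolvents of `F + B` for small stepsizes, and `F + B` is maximal monotone.
-/

namespace InertialTseng

open Filter
open scoped InnerProductSpace NNReal Pointwise Topology

section NormedGroup

variable {H : Type*} [NormedAddCommGroup H] {C D : Set H} {F : H → H} {B : H → Set H} {x p z u : H}

theorem IsProj.mem (h : IsProj C x p) : p ∈ C :=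
  ((h p).2 rfl).1

theorem IsProj.norm_sub_le (h : IsProj C x p) (hz : z ∈ C) : ‖p - x‖ ≤ ‖z - x‖ :=
  ((h p).2 rfl).2 z hz

theorem IsProj.infDist_eq (h : IsProj C x p) : Metric.infDist x C = ‖p - x‖ := by
  refine le_antisymm ?_ ((Metric.le_infDist ⟨p, h.mem⟩).2 fun z hz => ?_)
  · rw [← dist_eq_norm']
    exact Metric.infDist_le_dist_of_mem h.mem
  · rw [dist_eq_norm']
    exact h.norm_sub_le hz

theorem mem_opAdd_ofMap : u ∈ opAdd (ofMap F D) B x ↔ x ∈ D ∧ u - F x ∈ B x := by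
  simp only [opAdd, ofMap, Set.mem_add, Set.mem_ofPred_eq]
  constructor
  · rintro ⟨_, ⟨hx, rfl⟩, b, hb, rfl⟩
    exact ⟨hx, by rwa [add_sub_cancel_left]⟩
  · rintro ⟨hx, hb⟩
    exact ⟨F x, ⟨hx, rfl⟩, u - F x, hb, add_sub_cancel _ _⟩

end NormedGroup

variable {H : Type*} [NormedAddCommGroup H] [InnerProductSpace ℝ H]

section Projection

/-- The closed half-space through `a` with outward normal `v`; it is all of `H` if `v = 0`. Both
cuts `H_k` and `W_k` of the method have this form. -/
def halfSpace (a v : H) : Set H := {z | ⟪z - a, v⟫_ℝ ≤ 0}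

theorem isClosed_halfSpace (a v : H) : IsClosed (halfSpace a v) :=
  isClosed_le (by fun_prop) continuous_const

theorem convex_halfSpace (a v : H) : Convex ℝ (halfSpace a v) := by
  have h : halfSpace a v = {z | innerSL ℝ v z ≤ ⟪a, v⟫_ℝ} := by
    ext z
    simp [halfSpace, inner_sub_left, real_inner_comm]
  rw [h]
  exact convex_halfSpace_le (innerSL ℝ v).toLinearMap.isLinear _

variable {C : Set H} {x p z : H}

theorem norm_sq_add_norm_sq_le_of_mem_halfSpace (h : z ∈ halfSpace p (x - p)) :
    ‖p - x‖ ^ 2 + ‖z - p‖ ^ 2 ≤ ‖z - x‖ ^ 2 := by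
  have hz : ⟪z - p, x - p⟫_ℝ ≤ 0 := h
  rw [← sub_sub_sub_cancel_right z x p, norm_sub_sq_real (z - p), norm_sub_rev p x]
  linarith

theorem IsProj.subset_halfSpace (h : IsProj C x p) (hC : Convex ℝ C) :
    C ⊆ halfSpace p (x - p) := by
  have : Nonempty C := ⟨⟨p, h.mem⟩⟩
  have hmin : ‖x - p‖ = ⨅ z : C, ‖x - z‖ := by
    refine le_antisymm (le_ciInf fun z => ?_)
      (ciInf_le (f := fun z : C => ‖x - z‖) ⟨0, by rintro _ ⟨z, rfl⟩; positivity⟩ ⟨p, h.mem⟩)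
    rw [norm_sub_rev x, norm_sub_rev x]
    exact h.norm_sub_le z.2
  intro z hz
  have hinner := (norm_eq_iInf_iff_real_inner_le_zero hC h.mem).1 hmin z hz
  rwa [real_inner_comm] at hinner

theorem isProj_of_subset_halfSpace (hp : p ∈ C) (hC : C ⊆ halfSpace p (x - p)) :
    IsProj C x p := by
  have pythagoras : ∀ z ∈ C, ‖p - x‖ ^ 2 + ‖z - p‖ ^ 2 ≤ ‖z - x‖ ^ 2 := fun z hz =>
    norm_sq_add_norm_sq_le_of_mem_halfSpace (hC hz)
  refine fun q => ⟨fun ⟨hq, hmin⟩ => ?_, ?_⟩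
  · have hsq := pow_le_pow_left₀ (norm_nonneg _) (hmin p hp) 2
    have hqp : ‖q - p‖ ^ 2 = 0 := le_antisymm (by linarith [pythagoras q hq]) (sq_nonneg _)
    rwa [sq_eq_zero_iff, norm_sub_eq_zero_iff] at hqp
  · rintro rfl
    refine ⟨hp, fun z hz => le_of_sq_le_sq ?_ (norm_nonneg _)⟩
    linarith [pythagoras z hz, sq_nonneg ‖z - q‖]

theorem exists_isProj [CompleteSpace H] (hne : C.Nonempty) (hcl : IsClosed C)
    (hconv : Convex ℝ C) (x : H) : ∃ p, IsProj C x p := by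
  obtain ⟨p, hp, hmin⟩ := exists_norm_eq_iInf_of_complete_convex hne hcl.isComplete hconv x
  refine ⟨p, isProj_of_subset_halfSpace hp fun z hz => ?_⟩
  have hinner := (norm_eq_iInf_iff_real_inner_le_zero hconv hp).1 hmin z hz
  rwa [real_inner_comm] at hinner

end Projection

section WeakConvergence

variable {ι : Type*} {l : Filter ι} {x y : ι → H} {p q : H} {R : ℝ}

/-- Weak convergence of a family of vectors along a filter, tested against inner products. -/
def WeakTendsto (x : ι → H) (l : Filter ι) (p : H) : Prop :=
  ∀ z : H, Tendsto (fun i => ⟪x i, z⟫_ℝ) l (𝓝 ⟪p, z⟫_ℝ)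

theorem WeakTendsto.add (hx : WeakTendsto x l p) (hy : WeakTendsto y l q) :
    WeakTendsto (fun i => x i + y i) l (p + q) := fun z => by
  simpa only [inner_add_left] using (hx z).add (hy z)

theorem weakTendsto_of_tendsto (h : Tendsto x l (𝓝 p)) : WeakTendsto x l p := fun _ =>
  h.inner tendsto_const_nhds

theorem WeakTendsto.sub_const (h : WeakTendsto x l p) (c : H) :
    WeakTendsto (fun i => x i - c) l (p - c) := by
  simpa only [sub_eq_add_neg] using h.add (weakTendsto_of_tendsto tendsto_const_nhds)

theorem exists_weakTendsto_of_norm_le [CompleteSpace H] (U : Ultrafilter ι)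
    (hR : ∀ i, ‖x i‖ ≤ R) : ∃ p, WeakTendsto x U p := by
  let φ : ι → WeakDual ℝ H := fun i => StrongDual.toWeakDual (InnerProductSpace.toDual ℝ H (x i))
  have hφ : ∀ i, φ i ∈ WeakDual.toStrongDual ⁻¹' Metric.closedBall (0 : StrongDual ℝ H) R :=
    fun i => by simpa [φ] using hR i
  obtain ⟨ψ, -, hψ⟩ := (WeakDual.isCompact_closedBall (0 : StrongDual ℝ H) R).ultrafilter_le_nhds
    (U.map φ) (le_principal_iff.2 (mem_map.2 (Eventually.of_forall hφ)))
  refine ⟨(InnerProductSpace.toDual ℝ H).symm (WeakDual.toStrongDual ψ), fun z => ?_⟩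
  rw [InnerProductSpace.toDual_symm_apply]
  exact ((WeakDual.eval_continuous z).tendsto ψ).comp (show Tendsto φ U (𝓝 ψ) from hψ)

theorem WeakTendsto.norm_le [l.NeBot] (h : WeakTendsto x l p) (hR : ∀ i, ‖x i‖ ≤ R) :
    ‖p‖ ≤ R := by
  have hinner : ⟪p, p⟫_ℝ ≤ R * ‖p‖ := le_of_tendsto (h p) (Eventually.of_forall fun i =>
    (real_inner_le_norm _ _).trans (mul_le_mul_of_nonneg_right (hR i) (norm_nonneg p)))
  rw [real_inner_self_eq_norm_mul_norm] at hinner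
  rcases (norm_nonneg p).eq_or_lt with hp | hp
  · obtain ⟨i⟩ := l.nonempty_of_neBot
    exact hp ▸ (norm_nonneg _).trans (hR i)
  · exact le_of_mul_le_mul_right hinner hp

theorem WeakTendsto.tendsto_of_norm_le (h : WeakTendsto x l p) (hx : ∀ i, ‖x i‖ ≤ ‖p‖) :
    Tendsto x l (𝓝 p) := by
  have hlim : Tendsto (fun i => 2 * (‖p‖ ^ 2 - ⟪x i, p⟫_ℝ)) l (𝓝 0) := by
    have hinner := ((h p).const_sub (‖p‖ ^ 2)).const_mul 2
    rwa [real_inner_self_eq_norm_sq, sub_self, mul_zero] at hinner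
  have hbound : ∀ i, ‖x i - p‖ ^ 2 ≤ 2 * (‖p‖ ^ 2 - ⟪x i, p⟫_ℝ) := fun i => by
    rw [norm_sub_sq_real]
    linarith [pow_le_pow_left₀ (norm_nonneg _) (hx i) 2]
  rw [tendsto_iff_norm_sub_tendsto_zero]
  simpa only [Real.sqrt_sq (norm_nonneg _), Real.sqrt_zero] using
    (squeeze_zero (fun i => sq_nonneg _) hbound hlim).sqrt

theorem IsProj.tendsto_of_weakTendsto_mem [CompleteSpace H] {S : Set H} {x₀ : H}
    (hp : IsProj S x₀ p) (hx : ∀ i, ‖x i - x₀‖ ≤ ‖p - x₀‖)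
    (hweak : ∀ (U : Ultrafilter ι) (q : H), ↑U ≤ l → WeakTendsto x U q → q ∈ S) :
    Tendsto x l (𝓝 p) := by
  rw [tendsto_iff_ultrafilter]
  intro U hU
  obtain ⟨r, hr⟩ := exists_weakTendsto_of_norm_le U hx
  have hxr : WeakTendsto x U (r + x₀) := by
    simpa only [sub_add_cancel] using hr.add (weakTendsto_of_tendsto (tendsto_const_nhds (x := x₀)))
  have hrp : r + x₀ = p := (hp _).1 ⟨hweak U _ hU hxr, fun z hz => by
    rw [add_sub_cancel_right]
    exact (hr.norm_le hx).trans (hp.norm_sub_le hz)⟩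
  rw [← hrp, add_sub_cancel_right] at hx
  simpa only [sub_add_cancel, hrp] using (hr.tendsto_of_norm_le hx).add_const x₀

end WeakConvergence

section MonotoneOperators

variable {T S : H → Set H} {x y u v : H}

theorem IsMonotoneOp.opAdd (hT : IsMonotoneOp T) (hS : IsMonotoneOp S) :
    IsMonotoneOp (opAdd T S) := by
  rintro x y _ ⟨t, ht, s, hs, rfl⟩ _ ⟨t', ht', s', hs', rfl⟩
  rw [add_sub_add_comm, inner_add_right]
  exact add_nonneg (hT x y t ht t' ht') (hS x y s hs s' hs')

theorem isMonotoneOp_ofMap_iff {F : H → H} {D : Set H} :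
    IsMonotoneOp (ofMap F D) ↔ ∀ x ∈ D, ∀ y ∈ D, 0 ≤ ⟪x - y, F x - F y⟫_ℝ := by
  constructor
  · exact fun h x hx y hy => h x y _ ⟨hx, rfl⟩ _ ⟨hy, rfl⟩
  · rintro h x y _ ⟨hx, rfl⟩ _ ⟨hy, rfl⟩
    exact h x hx y hy

theorem IsMonotoneOp.opInv_subset_halfSpace (hT : IsMonotoneOp T) (hv : v ∈ T y) (u : H) :
    opInv T u ⊆ halfSpace y (v - u) := by
  intro x (hx : u ∈ T x)
  have h := hT x y u hx v hv
  rw [← neg_sub v u, inner_neg_right] at h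
  exact nonpos_of_neg_nonneg h

theorem isMaximalMonotoneOp_iff : IsMaximalMonotoneOp T ↔ IsMonotoneOp T ∧
    ∀ x u, (∀ z, ∀ v ∈ T z, 0 ≤ ⟪x - z, u - v⟫_ℝ) → u ∈ T x := by
  refine and_congr_right fun hT => ⟨fun hmax x u h => ?_, fun h T' hT' hTT' => ?_⟩
  · have hext : IsMonotoneOp fun z => T z ∪ {v | z = x ∧ v = u} := by
      rintro a b s (hs | ⟨rfl, rfl⟩) t (ht | ⟨rfl, rfl⟩)
      · exact hT a b s hs t ht
      · rw [← neg_sub b a, ← neg_sub t s, inner_neg_neg]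
        exact h a s hs
      · exact h b t ht
      · simp only [sub_self, inner_zero_left, le_refl]
    rw [← hmax _ hext fun z => Set.subset_union_left]
    exact Or.inr ⟨rfl, rfl⟩
  · funext x
    exact Set.Subset.antisymm
      (fun u hu => h x u fun z v hv => hT' x z u hu v (hTT' z hv)) (hTT' x)

theorem IsMaximalMonotoneOp.mem_of_forall_inner (hT : IsMaximalMonotoneOp T)
    (h : ∀ z, ∀ v ∈ T z, 0 ≤ ⟪x - z, u - v⟫_ℝ) : u ∈ T x :=
  (isMaximalMonotoneOp_iff.1 hT).2 x u h

theorem IsMaximalMonotoneOp.nonempty_opDom (hT : IsMaximalMonotoneOp T) : (opDom T).Nonempty := by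
  by_contra! hempty
  rw [Set.eq_empty_iff_forall_notMem] at hempty
  exact hempty 0 ⟨0, hT.mem_of_forall_inner fun z v hv => (hempty z ⟨v, hv⟩).elim⟩

theorem IsMaximalMonotoneOp.opInv_eq_iInter_halfSpace (hT : IsMaximalMonotoneOp T) (u : H) :
    opInv T u = ⋂ (z) (v) (_ : v ∈ T z), halfSpace z (v - u) := by
  refine Set.Subset.antisymm ?_ fun x hx => hT.mem_of_forall_inner fun z v hv => ?_
  · exact Set.subset_iInter fun z => Set.subset_iInter fun v => Set.subset_iInter fun hv =>
      hT.1.opInv_subset_halfSpace hv u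
  · have h : ⟪x - z, v - u⟫_ℝ ≤ 0 := by
      simp only [Set.mem_iInter] at hx
      exact hx z v hv
    rw [← neg_sub v u, inner_neg_right]
    exact neg_nonneg.2 h

theorem IsMaximalMonotoneOp.isClosed_opInv (hT : IsMaximalMonotoneOp T) (u : H) :
    IsClosed (opInv T u) := by
  rw [hT.opInv_eq_iInter_halfSpace]
  exact isClosed_iInter fun z => isClosed_iInter fun v => isClosed_iInter fun _ =>
    isClosed_halfSpace z (v - u)

theorem IsMaximalMonotoneOp.convex_opInv (hT : IsMaximalMonotoneOp T) (u : H) :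
    Convex ℝ (opInv T u) := by
  rw [hT.opInv_eq_iInter_halfSpace]
  exact convex_iInter fun z => convex_iInter fun v => convex_iInter fun _ =>
    convex_halfSpace z (v - u)

theorem IsMaximalMonotoneOp.mem_of_weakTendsto_of_tendsto {ι : Type*} {l : Filter ι} [l.NeBot]
    {y v : ι → H} {q u : H} (hT : IsMaximalMonotoneOp T) (hmem : ∀ i, v i ∈ T (y i))
    (hbdd : IsBoundedUnder (· ≤ ·) l fun i => ‖y i‖) (hy : WeakTendsto y l q)
    (hv : Tendsto v l (𝓝 u)) : u ∈ T q := by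
  refine hT.mem_of_forall_inner fun z r hr => ?_
  have hvu : Tendsto (fun i => v i - u) l (𝓝 0) := tendsto_sub_nhds_zero_iff.2 hv
  have hyv : Tendsto (fun i => ⟪y i, v i - u⟫_ℝ) l (𝓝 0) :=
    (hvu.op_zero_isBoundedUnder_le hbdd (fun a b => ⟪b, a⟫_ℝ) fun a b =>
      (norm_inner_le_norm b a).trans_eq (mul_comm _ _))
  have hzv : Tendsto (fun i => ⟪z, v i - u⟫_ℝ) l (𝓝 0) := by
    simpa only [inner_zero_right] using (tendsto_const_nhds (x := z)).inner hvu
  have hlim : Tendsto (fun i => ⟪y i - z, v i - r⟫_ℝ) l (𝓝 ⟪q - z, u - r⟫_ℝ) := by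
    have h := (hyv.sub hzv).add (hy.sub_const z (u - r))
    rw [sub_zero, zero_add] at h
    refine h.congr fun i => ?_
    rw [← inner_sub_left, ← inner_add_right, sub_add_sub_cancel]
  exact ge_of_tendsto' hlim fun i => hT.1 _ _ _ (hmem i) _ hr

theorem IsMaximalMonotoneOp.affine_preimage (hT : IsMaximalMonotoneOp T) {c : ℝ} (hc : 0 < c)
    (a : H) : IsMaximalMonotoneOp fun x => {u | c • (u + a) ∈ T x} := by
  refine isMaximalMonotoneOp_iff.2 ⟨fun x y u hu v hv => ?_, fun x u h => ?_⟩
  · have huv := hT.1 x y _ hu _ hv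
    rw [← smul_sub, add_sub_add_right_eq_sub, real_inner_smul_right] at huv
    exact nonneg_of_mul_nonneg_right huv hc
  · refine hT.mem_of_forall_inner fun z v hv => ?_
    have huv := h z (c⁻¹ • v - a) (by
      rwa [Set.mem_ofPred_eq, sub_add_cancel, smul_inv_smul₀ hc.ne'])
    have hcomb : c • (u + a) - v = c • (u - (c⁻¹ • v - a)) := by
      rw [sub_sub_eq_add_sub, smul_sub, smul_inv_smul₀ hc.ne']
    rw [hcomb, real_inner_smul_right]
    exact mul_nonneg hc.le huv

end MonotoneOperators

section EpigraphMinimization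

variable {E : Type*} [NormedAddCommGroup E] [InnerProductSpace ℝ E] {K : Set (E × ℝ)}
  {p q r : E × ℝ}

/-- The objective `t + ‖x‖² / 2`. On the epigraph of a convex function `φ` its minimization is the
minimization of `φ + ‖·‖² / 2`, which avoids handling extended-real values of `φ`. -/
noncomputable def epiEnergy (q : E × ℝ) : ℝ := q.2 + 1 / 2 * ‖q.1‖ ^ 2

theorem norm_sub_sq_le_of_forall_le_epiEnergy (hK : Convex ℝ K) {m : ℝ}
    (hm : ∀ s ∈ K, m ≤ epiEnergy s) (hq : q ∈ K) (hr : r ∈ K) :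
    ‖q.1 - r.1‖ ^ 2 ≤ 4 * ((epiEnergy q - m) + (epiEnergy r - m)) := by
  have hmid := hm _ (hK hq hr (a := 1 / 2) (b := 1 / 2) (by norm_num) (by norm_num) (by norm_num))
  have hnorm : ‖(1 / 2 : ℝ) • q.1 + (1 / 2 : ℝ) • r.1‖ ^ 2 =
      ‖q.1‖ ^ 2 / 2 + ‖r.1‖ ^ 2 / 2 - ‖q.1 - r.1‖ ^ 2 / 4 := by
    rw [← smul_add, norm_smul, mul_pow, norm_add_sq_real, norm_sub_sq_real]
    norm_num
    ring
  simp only [epiEnergy, Prod.fst_add, Prod.snd_add, Prod.smul_fst, Prod.smul_snd, smul_eq_mul]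
    at hmid ⊢
  linarith

theorem exists_isMinOn_epiEnergy [CompleteSpace E] (hne : K.Nonempty) (hcl : IsClosed K)
    (hconv : Convex ℝ K) (hbdd : BddBelow (epiEnergy '' K)) :
    ∃ p ∈ K, IsMinOn epiEnergy K p := by
  obtain ⟨e, -, he, hmem⟩ := exists_seq_tendsto_sInf (hne.image epiEnergy) hbdd
  set m := sInf (epiEnergy '' K)
  have hm : ∀ s ∈ K, m ≤ epiEnergy s := fun s hs => csInf_le hbdd ⟨s, hs, rfl⟩
  choose q hq hqe using hmem
  have hgap : Tendsto (fun n => e n - m) atTop (𝓝 0) := tendsto_sub_nhds_zero_iff.2 he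
  have hcauchy : CauchySeq fun n => (q n).1 := by
    rw [cauchySeq_iff_tendsto_dist_atTop_0]
    have hsum : Tendsto (fun n : ℕ × ℕ => 4 * ((e n.1 - m) + (e n.2 - m))) atTop (𝓝 0) := by
      rw [← prod_atTop_atTop_eq]
      simpa only [add_zero, mul_zero, Function.comp_apply] using
        ((hgap.comp tendsto_fst).add (hgap.comp tendsto_snd)).const_mul 4
    refine squeeze_zero (fun _ => dist_nonneg) (fun n => Real.le_sqrt_of_sq_le ?_)
      (Real.sqrt_zero ▸ hsum.sqrt)
    rw [dist_eq_norm, ← hqe, ← hqe]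
    exact norm_sub_sq_le_of_forall_le_epiEnergy hconv hm (hq n.1) (hq n.2)
  obtain ⟨x, hx⟩ := cauchySeq_tendsto_of_complete hcauchy
  have ht : Tendsto (fun n => (q n).2) atTop (𝓝 (m - 1 / 2 * ‖x‖ ^ 2)) := by
    refine (he.sub ((hx.norm.pow 2).const_mul (1 / 2))).congr fun n => ?_
    rw [← hqe, epiEnergy, add_sub_cancel_right]
  refine ⟨(x, m - 1 / 2 * ‖x‖ ^ 2),
    hcl.mem_of_tendsto (hx.prodMk_nhds ht) (Eventually.of_forall hq), fun s hs => ?_⟩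
  rw [Set.mem_ofPred_eq, epiEnergy, sub_add_cancel]
  exact hm s hs

theorem nonneg_of_isMinOn_epiEnergy (hK : Convex ℝ K) (hp : p ∈ K)
    (hmin : IsMinOn epiEnergy K p) (hq : q ∈ K) : 0 ≤ q.2 - p.2 + ⟪p.1, q.1 - p.1⟫_ℝ := by
  have hderiv := ((hasFDerivAt_snd (𝕜 := ℝ) (p := p)).add
    ((hasFDerivAt_fst (𝕜 := ℝ) (p := p)).norm_sq.const_mul (1 / 2))).hasFDerivWithinAt (s := K)
  have h := hmin.localize.hasFDerivWithinAt_nonneg hderiv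
    (sub_mem_posTangentConeAt_of_segment_subset (hK.segment_subset hp hq))
  simpa using h

end EpigraphMinimization

section Minty

variable {T : H → Set H} {x y u v w : H} {lam : ℝ}

/-- The epigraph of the Fitzpatrick function
`(x, u) ↦ sup {⟪x, v⟫ + ⟪z, u⟫ - ⟪z, v⟫ | v ∈ T z}` of `T`, over the Hilbert product `H × H`. -/
def fitzpatrickEpi (T : H → Set H) : Set (WithLp 2 (H × H) × ℝ) :=
  {q | ∀ z, ∀ v ∈ T z, ⟪q.1.fst, v⟫_ℝ + ⟪z, q.1.snd⟫_ℝ - ⟪z, v⟫_ℝ ≤ q.2}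

theorem isClosed_fitzpatrickEpi (T : H → Set H) : IsClosed (fitzpatrickEpi T) := by
  simp only [fitzpatrickEpi, Set.ofPred_forall]
  exact isClosed_iInter fun z => isClosed_iInter fun v => isClosed_iInter fun _ =>
    isClosed_le (by fun_prop) continuous_snd

theorem convex_fitzpatrickEpi (T : H → Set H) : Convex ℝ (fitzpatrickEpi T) := by
  intro q hq r hr a b ha hb hab z v hv
  have hqr := add_le_add (mul_le_mul_of_nonneg_left (hq z v hv) ha)
    (mul_le_mul_of_nonneg_left (hr z v hv) hb)
  simp only [Prod.fst_add, Prod.snd_add, Prod.smul_fst, Prod.smul_snd, smul_eq_mul,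
    WithLp.add_fst, WithLp.add_snd, WithLp.smul_fst, WithLp.smul_snd, inner_add_left,
    inner_add_right, real_inner_smul_left, real_inner_smul_right]
  linear_combination hqr + ⟪z, v⟫_ℝ * hab

theorem IsMonotoneOp.mem_fitzpatrickEpi (hT : IsMonotoneOp T) (hu : u ∈ T x) :
    (WithLp.toLp 2 (x, u), ⟪x, u⟫_ℝ) ∈ fitzpatrickEpi T := by
  intro z v hv
  have h := hT x z u hu v hv
  simp only [inner_sub_left, inner_sub_right] at h
  change ⟪x, v⟫_ℝ + ⟪z, u⟫_ℝ - ⟪z, v⟫_ℝ ≤ ⟪x, u⟫_ℝ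
  linarith

theorem IsMaximalMonotoneOp.inner_le_of_mem_fitzpatrickEpi (hT : IsMaximalMonotoneOp T)
    {q : WithLp 2 (H × H) × ℝ} (hq : q ∈ fitzpatrickEpi T) : ⟪q.1.fst, q.1.snd⟫_ℝ ≤ q.2 := by
  by_contra! hlt
  have hmem : q.1.snd ∈ T q.1.fst := hT.mem_of_forall_inner fun z v hv => by
    have h := hq z v hv
    simp only [inner_sub_left, inner_sub_right]
    linarith
  linarith [hq _ _ hmem]

theorem IsMaximalMonotoneOp.exists_norm_add_sq_le_inner [CompleteSpace H]
    (hT : IsMaximalMonotoneOp T) :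
    ∃ x u, ∀ z, ∀ v ∈ T z, ‖x + u‖ ^ 2 ≤ ⟪-u - z, -x - v⟫_ℝ := by
  obtain ⟨x₁, u₁, hu₁⟩ := hT.nonempty_opDom
  have hbdd : BddBelow (epiEnergy '' fitzpatrickEpi T) := by
    refine ⟨0, ?_⟩
    rintro _ ⟨q, hq, rfl⟩
    have hq' := hT.inner_le_of_mem_fitzpatrickEpi hq
    have hsq := norm_add_sq_real q.1.fst q.1.snd
    rw [epiEnergy, WithLp.prod_norm_sq_eq_of_L2]
    linarith [sq_nonneg ‖q.1.fst + q.1.snd‖]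
  obtain ⟨p, hp, hmin⟩ := exists_isMinOn_epiEnergy ⟨_, hT.1.mem_fitzpatrickEpi hu₁⟩
    (isClosed_fitzpatrickEpi T) (convex_fitzpatrickEpi T) hbdd
  refine ⟨p.1.fst, p.1.snd, fun z v hv => ?_⟩
  have hfirst := nonneg_of_isMinOn_epiEnergy (convex_fitzpatrickEpi T) hp hmin
    (hT.1.mem_fitzpatrickEpi hv)
  have hp' := hT.inner_le_of_mem_fitzpatrickEpi hp
  rw [WithLp.prod_inner_apply] at hfirst
  change 0 ≤ ⟪z, v⟫_ℝ - p.2 + (⟪p.1.fst, z - p.1.fst⟫_ℝ + ⟪p.1.snd, v - p.1.snd⟫_ℝ) at hfirst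
  have hcomm := real_inner_comm z p.1.fst
  have hcomm' := real_inner_comm p.1.snd p.1.fst
  simp only [inner_sub_left, inner_sub_right, inner_neg_left, inner_neg_right, norm_add_sq_real,
    real_inner_self_eq_norm_sq] at hfirst ⊢
  linarith

theorem IsMaximalMonotoneOp.exists_neg_mem [CompleteSpace H] (hT : IsMaximalMonotoneOp T) :
    ∃ x, -x ∈ T x := by
  obtain ⟨x, u, h⟩ := hT.exists_norm_add_sq_le_inner
  have hmem : -x ∈ T (-u) :=
    hT.mem_of_forall_inner fun z v hv => (sq_nonneg _).trans (h z v hv)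
  have hnorm : ‖x + u‖ ^ 2 ≤ 0 := by simpa only [sub_self, inner_zero_left] using h _ _ hmem
  have hxu : x + u = 0 := norm_eq_zero.1 (sq_nonpos_iff _ |>.1 hnorm)
  exact ⟨x, by rwa [← eq_neg_of_add_eq_zero_left hxu] at hmem⟩

theorem mem_opResolvent (hlam : lam ≠ 0) :
    y ∈ opResolvent lam T w ↔ (1 / lam) • (w - y) ∈ T y := by
  simp only [opResolvent, opInv, opAdd, Set.mem_ofPred_eq, Set.add_singleton,
    Set.image_add_right, Set.mem_preimage]
  rw [Set.mem_smul_set_iff_inv_smul_mem₀ hlam, one_div, sub_eq_add_neg]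

theorem mem_opResolvent_sub_smul (hlam : lam ≠ 0) (f : H) :
    y ∈ opResolvent lam T (w - lam • f) ↔ (1 / lam) • (w - y) - f ∈ T y := by
  rw [mem_opResolvent hlam, sub_right_comm, smul_sub _ (w - y), one_div, inv_smul_smul₀ hlam]

theorem IsMaximalMonotoneOp.nonempty_opResolvent [CompleteSpace H] (hT : IsMaximalMonotoneOp T)
    (hlam : 0 < lam) (w : H) : (opResolvent lam T w).Nonempty := by
  obtain ⟨y, hy⟩ := (hT.affine_preimage (one_div_pos.2 hlam) w).exists_neg_mem
  refine ⟨y, (mem_opResolvent hlam.ne').2 ?_⟩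
  rwa [sub_eq_neg_add]

theorem IsMonotoneOp.norm_sub_le_of_mem_opResolvent (hT : IsMonotoneOp T) (hlam : 0 < lam)
    {w₁ w₂ y₁ y₂ : H} (h₁ : y₁ ∈ opResolvent lam T w₁) (h₂ : y₂ ∈ opResolvent lam T w₂) :
    ‖y₁ - y₂‖ ≤ ‖w₁ - w₂‖ := by
  have h := hT _ _ _ ((mem_opResolvent hlam.ne').1 h₁) _ ((mem_opResolvent hlam.ne').1 h₂)
  rw [← smul_sub, real_inner_smul_right, sub_sub_sub_comm, inner_sub_right,
    real_inner_self_eq_norm_mul_norm] at h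
  have hinner := nonneg_of_mul_nonneg_right h (one_div_pos.2 hlam)
  rcases (norm_nonneg (y₁ - y₂)).eq_or_lt with h0 | hpos
  · exact h0 ▸ norm_nonneg _
  · refine le_of_mul_le_mul_left ?_ hpos
    linarith [real_inner_le_norm (y₁ - y₂) (w₁ - w₂)]

theorem IsMonotoneOp.isMaximalMonotoneOp_of_nonempty_opResolvent (hT : IsMonotoneOp T)
    (hlam : 0 < lam) (hres : ∀ w, (opResolvent lam T w).Nonempty) : IsMaximalMonotoneOp T := by
  refine isMaximalMonotoneOp_iff.2 ⟨hT, fun x u h => ?_⟩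
  obtain ⟨y, hy⟩ := hres (x + lam • u)
  have hmem := (mem_opResolvent hlam.ne').1 hy
  have hdiff : u - (1 / lam) • (x + lam • u - y) = -((1 / lam) • (x - y)) := by
    rw [add_sub_right_comm, smul_add, one_div, inv_smul_smul₀ hlam.ne']
    abel
  have hxy := h y _ hmem
  rw [hdiff, inner_neg_right, real_inner_smul_right, real_inner_self_eq_norm_sq] at hxy
  have hzero : ‖x - y‖ ^ 2 = 0 := by
    have := mul_nonneg (one_div_pos.2 hlam).le (sq_nonneg ‖x - y‖)
    exact (mul_eq_zero.1 (by linarith)).resolve_left (one_div_pos.2 hlam).ne'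
  have : x = y := by rwa [sq_eq_zero_iff, norm_sub_eq_zero_iff] at hzero
  subst this
  rwa [add_sub_cancel_left, one_div, inv_smul_smul₀ hlam.ne'] at hmem

end Minty

section ForwardBackward

variable {F : H → H} {C D : Set H} {B T : H → Set H} {y v w : H} {lam : ℝ} {K : ℝ≥0}

theorem mem_opResolvent_opAdd_ofMap (hlam : lam ≠ 0) :
    y ∈ opResolvent lam (opAdd (ofMap F D) B) w ↔
      y ∈ D ∧ y ∈ opResolvent lam B (w - lam • F y) := by
  rw [mem_opResolvent hlam, mem_opAdd_ofMap, mem_opResolvent_sub_smul hlam]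

theorem IsMaximalMonotoneOp.nonempty_opResolvent_opAdd_ofMap [CompleteSpace H]
    (hB : IsMaximalMonotoneOp B) (hF : LipschitzOnWith K F C) (hC : IsClosed C)
    (hBC : opDom B ⊆ C) (hCD : C ⊆ D) (hlam : 0 < lam) (hlamK : lam * K < 1) (w : H) :
    (opResolvent lam (opAdd (ofMap F D) B) w).Nonempty := by
  lift lam to ℝ≥0 using hlam.le
  choose J hJ using hB.nonempty_opResolvent hlam
  let step : H → H := fun z => J (w - (lam : ℝ) • F z)
  have hstepC : Set.MapsTo step C C := fun z _ =>
    hBC ⟨_, (mem_opResolvent hlam.ne').1 (hJ _)⟩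
  have hcontr : ContractingWith (lam * K) (hstepC.restrict step C C) := by
    refine ⟨by exact_mod_cast hlamK, LipschitzWith.of_dist_le_mul fun a b => ?_⟩
    calc dist (step a) (step b)
        ≤ ‖w - (lam : ℝ) • F a - (w - (lam : ℝ) • F b)‖ := by
          rw [dist_eq_norm]
          exact hB.1.norm_sub_le_of_mem_opResolvent hlam (hJ _) (hJ _)
      _ = lam * dist (F a) (F b) := by
          rw [sub_sub_sub_cancel_left, ← smul_sub, norm_smul, Real.norm_of_nonneg hlam.le,
            dist_eq_norm']
      _ ≤ lam * (K * dist a b) := by gcongr; exact hF.dist_le_mul a a.2 b b.2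
      _ = (lam * K : ℝ≥0) * dist a b := by push_cast; ring
  obtain ⟨x, hx⟩ := hB.nonempty_opDom
  obtain ⟨y, hy, hfix, -⟩ :=
    hcontr.exists_fixedPoint' hC.isComplete hstepC (hBC hx) (edist_ne_top _ _)
  refine ⟨y, (mem_opResolvent_opAdd_ofMap hlam.ne').2 ⟨hCD hy, ?_⟩⟩
  have hres := hJ (w - (lam : ℝ) • F y)
  rwa [show J (w - (lam : ℝ) • F y) = y from hfix] at hres

theorem IsMaximalMonotoneOp.opAdd_ofMap [CompleteSpace H] (hB : IsMaximalMonotoneOp B)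
    (hmono : IsMonotoneOp (ofMap F D)) (hF : LipschitzOnWith K F C) (hC : IsClosed C)
    (hBC : opDom B ⊆ C) (hCD : C ⊆ D) : IsMaximalMonotoneOp (opAdd (ofMap F D) B) := by
  have hlam : (0 : ℝ) < 1 / (K + 1) := by positivity
  have hlamK : 1 / ((K : ℝ) + 1) * K < 1 := by
    rw [one_div_mul_eq_div, div_lt_one (by positivity)]
    exact lt_add_one _
  exact (hmono.opAdd hB.1).isMaximalMonotoneOp_of_nonempty_opResolvent hlam
    (hB.nonempty_opResolvent_opAdd_ofMap hF hC hBC hCD hlam hlamK)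

theorem residual_mem_opAdd_ofMap (hlam : lam ≠ 0) (hBD : opDom B ⊆ D) {f : H}
    (hy : y ∈ opResolvent lam B (w - lam • f)) :
    F y - f + (1 / lam) • (w - y) ∈ opAdd (ofMap F D) B y := by
  rw [mem_opResolvent_sub_smul hlam] at hy
  refine mem_opAdd_ofMap.2 ⟨hBD ⟨_, hy⟩, ?_⟩
  rwa [add_sub_right_comm, sub_sub_cancel_left, neg_add_eq_sub]

theorem IsMonotoneOp.opInv_zero_subset_halfSpace_inter (hT : IsMonotoneOp T) (hv : v ∈ T y)
    {W : Set H} (hW : opInv T 0 ⊆ W) : opInv T 0 ⊆ halfSpace y v ∩ W := by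
  have hcut := hT.opInv_subset_halfSpace hv 0
  rw [sub_zero] at hcut
  exact Set.subset_inter hcut hW

theorem IsMonotoneOp.opInv_zero_subset_halfSpace_of_isProj (hT : IsMonotoneOp T) (hv : v ∈ T y)
    {x x₀ p : H} (hx : opInv T 0 ⊆ halfSpace x (x₀ - x))
    (hp : IsProj (halfSpace y v ∩ halfSpace x (x₀ - x)) x₀ p) :
    opInv T 0 ⊆ halfSpace p (x₀ - p) :=
  (hT.opInv_zero_subset_halfSpace_inter hv hx).trans
    (hp.subset_halfSpace ((convex_halfSpace _ _).inter (convex_halfSpace _ _)))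

end ForwardBackward

section ElementaryEstimates

variable {a c p v w y : H} {lam t σ : ℝ}

theorem sq_add_le_of_mem_halfSpace (hlam : 0 ≤ lam)
    (herr : ‖lam • v - (w - y)‖ ≤ σ * ‖w - y‖) (hp : p ∈ halfSpace y v) :
    (lam * ‖v‖) ^ 2 + (1 - σ ^ 2) * ‖w - y‖ ^ 2 ≤ 2 * ‖w - p‖ * (lam * ‖v‖) := by
  have hpv : ⟪p - y, v⟫_ℝ ≤ 0 := hp
  have hinner : ⟪w - y, v⟫_ℝ ≤ ‖w - p‖ * ‖v‖ := by
    rw [← sub_add_sub_cancel w p y, inner_add_left]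
    linarith [real_inner_le_norm (w - p) v]
  have hsq := pow_le_pow_left₀ (norm_nonneg _) herr 2
  rw [norm_sub_sq_real, norm_smul, Real.norm_of_nonneg hlam, real_inner_smul_left,
    real_inner_comm, mul_pow σ] at hsq
  linarith [mul_le_mul_of_nonneg_left hinner hlam]

theorem mul_norm_le_of_mem_halfSpace (hlam : 0 ≤ lam) (hσ : σ ^ 2 ≤ 1)
    (herr : ‖lam • v - (w - y)‖ ≤ σ * ‖w - y‖) (hp : p ∈ halfSpace y v) :
    lam * ‖v‖ ≤ 2 * ‖w - p‖ := by
  have h := sq_add_le_of_mem_halfSpace hlam herr hp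
  have hnonneg := mul_nonneg (sub_nonneg.2 hσ) (sq_nonneg ‖w - y‖)
  rcases (mul_nonneg hlam (norm_nonneg v)).eq_or_lt with hzero | hpos
  · exact hzero ▸ by positivity
  · refine le_of_mul_le_mul_right ?_ hpos
    linarith

theorem mul_norm_sub_sq_le_of_mem_halfSpace (hlam : 0 ≤ lam)
    (herr : ‖lam • v - (w - y)‖ ≤ σ * ‖w - y‖) (hp : p ∈ halfSpace y v) :
    (1 - σ ^ 2) * ‖w - y‖ ^ 2 ≤ ‖w - p‖ ^ 2 := by
  linarith [sq_add_le_of_mem_halfSpace hlam herr hp, sq_nonneg (‖w - p‖ - lam * ‖v‖)]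

theorem norm_add_smul_sq_le (ht : 0 ≤ t) (e f : H) :
    ‖e + t • f‖ ^ 2 ≤ (1 + t) * (‖e‖ ^ 2 + t * ‖f‖ ^ 2) := by
  have h := mul_nonneg ht (sq_nonneg ‖e - f‖)
  rw [norm_sub_sq_real] at h
  rw [norm_add_sq_real, real_inner_smul_right, norm_smul, Real.norm_of_nonneg ht]
  linarith

theorem norm_add_smul_sq_le_of_inner_nonpos (ht : 0 ≤ t) (hac : ⟪a, c⟫_ℝ ≤ 0) :
    ‖a + t • c‖ ^ 2 ≤ ‖a‖ ^ 2 + t ^ 2 * ‖c‖ ^ 2 := by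
  rw [norm_add_sq_real, real_inner_smul_right, norm_smul, Real.norm_of_nonneg ht, mul_pow]
  linarith [mul_nonpos_of_nonneg_of_nonpos ht hac]

end ElementaryEstimates

theorem tendsto_zero_of_sum_sq_le {E : Type*} [NormedAddCommGroup E] {u : ℕ → E} {M : ℝ}
    (h : ∀ n, ∑ i ∈ Finset.range n, ‖u i‖ ^ 2 ≤ M) : Tendsto u atTop (𝓝 0) := by
  have hsq := (summable_of_sum_range_le (fun i => sq_nonneg ‖u i‖) h).tendsto_atTop_zero
  rw [tendsto_zero_iff_norm_tendsto_zero]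
  simpa only [Real.sqrt_sq (norm_nonneg _), Real.sqrt_zero] using hsq.sqrt

theorem exists_le_of_sum_sq_le {e : ℕ → ℝ} {M : ℝ} {k : ℕ}
    (h : ∑ i ∈ Finset.range (k + 1), e i ^ 2 ≤ M) : ∃ j ≤ k, e j ≤ √M / √((k : ℝ) + 1) := by
  have hsum : ∑ i ∈ Finset.range (k + 1), e i ^ 2 ≤
      ∑ _i ∈ Finset.range (k + 1), M / ((k : ℝ) + 1) := by
    rw [Finset.sum_const, Finset.card_range, nsmul_eq_mul, Nat.cast_add_one,
      mul_div_cancel₀ _ (by positivity)]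
    exact h
  obtain ⟨j, hj, hle⟩ := Finset.exists_le_of_sum_le Finset.nonempty_range_add_one hsum
  refine ⟨j, Nat.lt_succ_iff.1 (Finset.mem_range.1 hj), ?_⟩
  rw [← Real.sqrt_div' _ (by positivity)]
  exact Real.le_sqrt_of_sq_le hle

theorem bddAbove_range_of_summable_sq {β : ℕ → ℝ} (h : Summable fun k => β k ^ 2) :
    BddAbove (Set.range β) := by
  refine ⟨√(∑' i, β i ^ 2), ?_⟩
  rintro _ ⟨k, rfl⟩
  exact Real.le_sqrt_of_sq_le (h.le_tsum k fun i _ => sq_nonneg _)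

theorem exists_seq_of_step {X : Type*} {I : X → Prop} {R : ℕ → X → X → X → Prop} {x₀ : X}
    (h₀ : I x₀) (hstep : ∀ k a b, I b → ∃ c, I c ∧ R k a b c) :
    ∃ x : ℕ → X, x 0 = x₀ ∧ ∀ k, R k (x (k - 1)) (x k) (x (k + 1)) := by
  choose next hI hR using hstep
  let s : ℕ → X × {b // I b} := fun n => Nat.rec (x₀, ⟨x₀, h₀⟩)
    (fun k s => (s.2, ⟨next k s.1 s.2 s.2.2, hI k s.1 s.2 s.2.2⟩)) n
  have hpred : ∀ k, (s k).1 = (s (k - 1)).2 := fun k => by cases k <;> rfl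
  refine ⟨fun k => (s k).2, rfl, fun k => ?_⟩
  beta_reduce
  rw [← hpred]
  exact hR k (s k).1 (s k).2 (s k).2.2

section Run

variable {F : H → H} {C D : Set H} {B : H → Set H} {lam : ℝ} {α β : ℕ → ℝ} {x0 xs : H}
  {K : ℝ≥0} {x w wt wp y v : ℕ → H}

theorem exists_isTsengRun [CompleteSpace H] (hB : IsMaximalMonotoneOp B)
    (hmono : IsMonotoneOp (opAdd (ofMap F D) B)) (hBD : opDom B ⊆ D) (hCne : C.Nonempty)
    (hCcl : IsClosed C) (hCconv : Convex ℝ C) (hS : (solSet F D B).Nonempty) (hlam : 0 < lam)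
    (α β : ℕ → ℝ) (x0 : H) :
    ∃ x w wt wp y v : ℕ → H, IsTsengRun F B C lam α β x0 x w wt wp y v := by
  choose P hP using exists_isProj hCne hCcl hCconv
  choose J hJ using hB.nonempty_opResolvent hlam
  let w : ℕ → H → H → H := fun k a b => b + α k • (b - a)
  let wt : ℕ → H → H → H := fun k a b => w k a b + β k • (w k a b - x0)
  let wp : ℕ → H → H → H := fun k a b => P (wt k a b)
  let y : ℕ → H → H → H := fun k a b => J (wt k a b - lam • F (wp k a b))
  let v : ℕ → H → H → H := fun k a b =>
    F (y k a b) - F (wp k a b) + (1 / lam) • (wt k a b - y k a b)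
  have hinit : solSet F D B ⊆ halfSpace x0 (x0 - x0) := fun z _ => by
    simp only [halfSpace, sub_self, inner_zero_right, Set.mem_ofPred_eq, le_refl]
  have hstep : ∀ k a b, solSet F D B ⊆ halfSpace b (x0 - b) → ∃ c,
      solSet F D B ⊆ halfSpace c (x0 - c) ∧
        IsProj (halfSpace (y k a b) (v k a b) ∩ halfSpace b (x0 - b)) x0 c := by
    intro k a b hb
    have hv := residual_mem_opAdd_ofMap (F := F) hlam.ne' hBD (hJ (wt k a b - lam • F (wp k a b)))
    have hsub := hmono.opInv_zero_subset_halfSpace_inter hv hb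
    obtain ⟨c, hc⟩ := exists_isProj (hS.mono hsub)
      ((isClosed_halfSpace _ _).inter (isClosed_halfSpace _ _))
      ((convex_halfSpace _ _).inter (convex_halfSpace _ _)) x0
    exact ⟨c, hmono.opInv_zero_subset_halfSpace_of_isProj hv hb hc, hc⟩
  obtain ⟨x, hx0, hx⟩ :=
    exists_seq_of_step (I := fun b => solSet F D B ⊆ halfSpace b (x0 - b)) hinit hstep
  exact ⟨x, fun k => w k (x (k - 1)) (x k), fun k => wt k (x (k - 1)) (x k),
    fun k => wp k (x (k - 1)) (x k), fun k => y k (x (k - 1)) (x k),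
    fun k => v k (x (k - 1)) (x k),
    { init := hx0, w_eq := fun _ => rfl, wt_eq := fun _ => rfl, wp_eq := fun _ => hP _,
      y_eq := fun _ => hJ _, v_eq := fun _ => rfl, x_succ := hx }⟩

theorem IsTsengRun.residual_mem (hr : IsTsengRun F B C lam α β x0 x w wt wp y v)
    (hlam : lam ≠ 0) (hBD : opDom B ⊆ D) (k : ℕ) : v k ∈ opAdd (ofMap F D) B (y k) := by
  rw [hr.v_eq]
  exact residual_mem_opAdd_ofMap hlam hBD (hr.y_eq k)

theorem IsTsengRun.mem_halfSpace_inter (hr : IsTsengRun F B C lam α β x0 x w wt wp y v) (k : ℕ) :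
    x (k + 1) ∈ halfSpace (y k) (v k) ∩ halfSpace (x k) (x0 - x k) :=
  (hr.x_succ k).mem

theorem IsTsengRun.opInv_zero_subset_halfSpace {T : H → Set H}
    (hr : IsTsengRun F B C lam α β x0 x w wt wp y v) (hT : IsMonotoneOp T)
    (hv : ∀ k, v k ∈ T (y k)) (k : ℕ) : opInv T 0 ⊆ halfSpace (x k) (x0 - x k) := by
  induction k with
  | zero =>
    intro z _
    simp only [halfSpace, hr.init, sub_self, inner_zero_right, Set.mem_ofPred_eq, le_refl]
  | succ k ih => exact hT.opInv_zero_subset_halfSpace_of_isProj (hv k) ih (hr.x_succ k)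

theorem IsTsengRun.norm_sub_le_of_mem_opInv_zero {T : H → Set H} {z : H}
    (hr : IsTsengRun F B C lam α β x0 x w wt wp y v) (hT : IsMonotoneOp T)
    (hv : ∀ k, v k ∈ T (y k)) (hz : z ∈ opInv T 0) (k : ℕ) : ‖x k - x0‖ ≤ ‖z - x0‖ := by
  have h := norm_sq_add_norm_sq_le_of_mem_halfSpace (hr.opInv_zero_subset_halfSpace hT hv k hz)
  exact le_of_sq_le_sq (by linarith [sq_nonneg ‖z - x k‖]) (norm_nonneg _)

theorem IsTsengRun.sum_norm_succ_sub_sq_le (hr : IsTsengRun F B C lam α β x0 x w wt wp y v)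
    (n : ℕ) : ∑ i ∈ Finset.range n, ‖x (i + 1) - x i‖ ^ 2 ≤ ‖x n - x0‖ ^ 2 := by
  induction n with
  | zero =>
    rw [Finset.sum_range_zero]
    exact sq_nonneg _
  | succ n ih =>
    rw [Finset.sum_range_succ]
    linarith [norm_sq_add_norm_sq_le_of_mem_halfSpace (hr.mem_halfSpace_inter n).2]

theorem IsTsengRun.sum_norm_sub_pred_sq_le (hr : IsTsengRun F B C lam α β x0 x w wt wp y v)
    (n : ℕ) : ∑ i ∈ Finset.range n, ‖x i - x (i - 1)‖ ^ 2 ≤ ‖x (n - 1) - x0‖ ^ 2 := by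
  cases n with
  | zero =>
    rw [Finset.sum_range_zero]
    exact sq_nonneg _
  | succ n =>
    rw [Finset.sum_range_succ']
    simpa using hr.sum_norm_succ_sub_sq_le n

theorem IsTsengRun.norm_wt_sub_succ_sq_le (hr : IsTsengRun F B C lam α β x0 x w wt wp y v)
    {k : ℕ} (hα : 0 ≤ α k) (hβ : 0 ≤ β k) :
    ‖wt k - x (k + 1)‖ ^ 2 ≤ (1 + α k) * (‖x (k + 1) - x k‖ ^ 2 +
      α k * (1 + β k) ^ 2 * ‖x k - x (k - 1)‖ ^ 2 + β k ^ 2 * ‖x k - x0‖ ^ 2) := by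
  have hinner : ⟪x k - x (k + 1), x k - x0⟫_ℝ ≤ 0 := by
    have h : ⟪x (k + 1) - x k, x0 - x k⟫_ℝ ≤ 0 := (hr.mem_halfSpace_inter k).2
    rwa [← inner_neg_neg, neg_sub, neg_sub] at h
  have hsplit : wt k - x (k + 1) =
      (x k - x (k + 1) + β k • (x k - x0)) + α k • ((1 + β k) • (x k - x (k - 1))) := by
    rw [hr.wt_eq, hr.w_eq]
    module
  calc ‖wt k - x (k + 1)‖ ^ 2
      ≤ (1 + α k) * (‖x k - x (k + 1) + β k • (x k - x0)‖ ^ 2 +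
          α k * ‖(1 + β k) • (x k - x (k - 1))‖ ^ 2) :=
        hsplit ▸ norm_add_smul_sq_le hα _ _
    _ ≤ (1 + α k) * ((‖x k - x (k + 1)‖ ^ 2 + β k ^ 2 * ‖x k - x0‖ ^ 2) +
          α k * ‖(1 + β k) • (x k - x (k - 1))‖ ^ 2) := by
        gcongr
        exact norm_add_smul_sq_le_of_inner_nonpos hβ hinner
    _ = _ := by
        rw [norm_smul, Real.norm_of_nonneg (by positivity), norm_sub_rev (x k) (x (k + 1))]
        ring

theorem IsTsengRun.sum_norm_wt_sub_succ_sq_le (hr : IsTsengRun F B C lam α β x0 x w wt wp y v)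
    {d a b : ℝ} (hd : ∀ k, ‖x k - x0‖ ≤ d) (hα : ∀ k, 0 ≤ α k) (hαa : ∀ k, α k ≤ a)
    (hβ : ∀ k, 0 ≤ β k) (hβb : ∀ k, β k ≤ b) (hβsum : Summable fun k => β k ^ 2) (n : ℕ) :
    ∑ i ∈ Finset.range n, ‖wt i - x (i + 1)‖ ^ 2 ≤
      d ^ 2 * ((1 + a) * ((1 + b) * (1 + a * (1 + b)) + ∑' i, β i ^ 2)) := by
  have ha : 0 ≤ a := (hα 0).trans (hαa 0)
  have hb : 0 ≤ b := (hβ 0).trans (hβb 0)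
  have hd' : ∀ k, ‖x k - x0‖ ^ 2 ≤ d ^ 2 := fun k => pow_le_pow_left₀ (norm_nonneg _) (hd k) 2
  have hterm : ∀ i, ‖wt i - x (i + 1)‖ ^ 2 ≤ (1 + a) * (‖x (i + 1) - x i‖ ^ 2 +
      a * (1 + b) ^ 2 * ‖x i - x (i - 1)‖ ^ 2 + β i ^ 2 * d ^ 2) := fun i => by
    have hαi := hα i
    have hβi := hβ i
    refine (hr.norm_wt_sub_succ_sq_le hαi hβi).trans ?_
    gcongr
    exacts [hαa i, hαa i, hβb i, hd i]
  have hstep : ∑ i ∈ Finset.range n, ‖x (i + 1) - x i‖ ^ 2 ≤ d ^ 2 :=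
    (hr.sum_norm_succ_sub_sq_le n).trans (hd' n)
  have hprev : ∑ i ∈ Finset.range n, ‖x i - x (i - 1)‖ ^ 2 ≤ d ^ 2 :=
    (hr.sum_norm_sub_pred_sq_le n).trans (hd' (n - 1))
  have hβtsum : ∑ i ∈ Finset.range n, β i ^ 2 ≤ ∑' i, β i ^ 2 :=
    hβsum.sum_le_tsum _ fun i _ => sq_nonneg _
  calc ∑ i ∈ Finset.range n, ‖wt i - x (i + 1)‖ ^ 2
      ≤ ∑ i ∈ Finset.range n, (1 + a) * (‖x (i + 1) - x i‖ ^ 2 +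
          a * (1 + b) ^ 2 * ‖x i - x (i - 1)‖ ^ 2 + β i ^ 2 * d ^ 2) :=
        Finset.sum_le_sum fun i _ => hterm i
    _ = (1 + a) * (∑ i ∈ Finset.range n, ‖x (i + 1) - x i‖ ^ 2 +
          a * (1 + b) ^ 2 * ∑ i ∈ Finset.range n, ‖x i - x (i - 1)‖ ^ 2 +
          (∑ i ∈ Finset.range n, β i ^ 2) * d ^ 2) := by
        rw [← Finset.mul_sum, Finset.sum_add_distrib, Finset.sum_add_distrib, Finset.mul_sum,
          Finset.sum_mul]
    _ ≤ (1 + a) * (d ^ 2 + a * (1 + b) ^ 2 * d ^ 2 + (∑' i, β i ^ 2) * d ^ 2) := by gcongr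
    _ = d ^ 2 * ((1 + a) * (1 + a * (1 + b) ^ 2 + ∑' i, β i ^ 2)) := by ring
    _ ≤ d ^ 2 * ((1 + a) * ((1 + b) * (1 + a * (1 + b)) + ∑' i, β i ^ 2)) := by
        gcongr
        linarith

theorem IsTsengRun.norm_smul_residual_sub_le (hr : IsTsengRun F B C lam α β x0 x w wt wp y v)
    (hF : LipschitzOnWith K F C) (hC : Convex ℝ C) (hBC : opDom B ⊆ C) (hlam : 0 < lam) (k : ℕ) :
    ‖lam • v k - (wt k - y k)‖ ≤ lam * K * ‖wt k - y k‖ := by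
  have hyC : y k ∈ C := hBC ⟨_, (mem_opResolvent hlam.ne').1 (hr.y_eq k)⟩
  have hproj : ‖y k - wp k‖ ≤ ‖wt k - y k‖ := by
    have h := norm_sq_add_norm_sq_le_of_mem_halfSpace ((hr.wp_eq k).subset_halfSpace hC hyC)
    rw [norm_sub_rev (wt k)]
    exact le_of_sq_le_sq (by linarith [sq_nonneg ‖wp k - wt k‖]) (norm_nonneg _)
  calc ‖lam • v k - (wt k - y k)‖
      = lam * ‖F (y k) - F (wp k)‖ := by
        rw [hr.v_eq, smul_add, one_div, smul_inv_smul₀ hlam.ne', add_sub_cancel_right, norm_smul,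
          Real.norm_of_nonneg hlam.le]
    _ ≤ lam * (K * ‖wt k - y k‖) := by
        gcongr
        exact (hF.norm_sub_le hyC (hr.wp_eq k).mem).trans (by gcongr)
    _ = lam * K * ‖wt k - y k‖ := (mul_assoc _ _ _).symm

theorem IsTsengRun.tendsto_isProj [CompleteSpace H] {T : H → Set H}
    (hr : IsTsengRun F B C lam α β x0 x w wt wp y v) (hT : IsMaximalMonotoneOp T)
    (hv : ∀ k, v k ∈ T (y k)) (hxs : IsProj (opInv T 0) x0 xs) (hv0 : Tendsto v atTop (𝓝 0))
    (hyx : Tendsto (fun k => y k - x k) atTop (𝓝 0)) : Tendsto x atTop (𝓝 xs) := by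
  have hx := hr.norm_sub_le_of_mem_opInv_zero hT.1 hv hxs.mem
  have hxbdd : ∀ k, ‖x k‖ ≤ ‖xs - x0‖ + ‖x0‖ := fun k => by
    linarith [norm_le_norm_sub_add (x k) x0, hx k]
  have hybdd : IsBoundedUnder (· ≤ ·) atTop fun k => ‖y k‖ := by
    obtain ⟨R, hR⟩ := hyx.norm.isBoundedUnder_le
    refine isBoundedUnder_of_eventually_le (a := R + (‖xs - x0‖ + ‖x0‖))
      ((eventually_map.1 hR).mono fun k hk => ?_)
    exact (norm_le_norm_sub_add (y k) (x k)).trans (add_le_add hk (hxbdd k))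
  refine hxs.tendsto_of_weakTendsto_mem hx fun U q hU hq => ?_
  have hyq : WeakTendsto y U q := by
    simpa only [sub_add_cancel, zero_add] using
      (weakTendsto_of_tendsto (hyx.mono_left hU)).add hq
  exact hT.mem_of_weakTendsto_of_tendsto hv (hybdd.mono hU) hyq (hv0.mono_left hU)

theorem IsTsengRun.tendsto [CompleteSpace H] {T : H → Set H}
    (hr : IsTsengRun F B C lam α β x0 x w wt wp y v) (hT : IsMaximalMonotoneOp T)
    (hv : ∀ k, v k ∈ T (y k)) (hxs : IsProj (opInv T 0) x0 xs)
    (hF : LipschitzOnWith K F C) (hC : Convex ℝ C) (hBC : opDom B ⊆ C) (hlam : 0 < lam)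
    (hlamK : lam * K < 1) {M : ℝ}
    (hM : ∀ n, ∑ i ∈ Finset.range n, ‖wt i - x (i + 1)‖ ^ 2 ≤ M) :
    Tendsto x atTop (𝓝 xs) ∧ Tendsto y atTop (𝓝 xs) := by
  have hσ : 0 < 1 - (lam * K) ^ 2 := by
    rw [sub_pos, sq_lt_one_iff₀ (by positivity)]
    exact hlamK
  have herr := hr.norm_smul_residual_sub_le hF hC hBC hlam
  have hwx : Tendsto (fun k => wt k - x (k + 1)) atTop (𝓝 0) := tendsto_zero_of_sum_sq_le hM
  have hv0 : Tendsto v atTop (𝓝 0) := by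
    have hbound : ∀ k, ‖v k‖ ≤ 2 * ‖wt k - x (k + 1)‖ / lam := fun k => by
      rw [le_div_iff₀' hlam]
      exact mul_norm_le_of_mem_halfSpace hlam.le (sub_pos.1 hσ).le (herr k)
        (hr.mem_halfSpace_inter k).1
    refine squeeze_zero_norm hbound ?_
    simpa only [norm_zero, mul_zero, zero_div] using (hwx.norm.const_mul 2).div_const lam
  have hwy : Tendsto (fun k => wt k - y k) atTop (𝓝 0) := by
    refine tendsto_zero_of_sum_sq_le (M := M / (1 - (lam * K) ^ 2)) fun n => ?_
    rw [le_div_iff₀' hσ, Finset.mul_sum]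
    exact (Finset.sum_le_sum fun i _ => mul_norm_sub_sq_le_of_mem_halfSpace hlam.le (herr i)
      (hr.mem_halfSpace_inter i).1).trans (hM n)
  have hxx : Tendsto (fun k => x (k + 1) - x k) atTop (𝓝 0) :=
    tendsto_zero_of_sum_sq_le fun n => (hr.sum_norm_succ_sub_sq_le n).trans
      (pow_le_pow_left₀ (norm_nonneg _) (hr.norm_sub_le_of_mem_opInv_zero hT.1 hv hxs.mem n) 2)
  have hyx : Tendsto (fun k => y k - x k) atTop (𝓝 0) := by
    have h := (hwx.sub hwy).add hxx
    rw [sub_zero, add_zero] at h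
    exact h.congr fun k => by abel
  have hx := hr.tendsto_isProj hT hv hxs hv0 hyx
  exact ⟨hx, by simpa only [sub_add_cancel, zero_add] using hyx.add hx⟩

theorem IsTsengRun.exists_mul_norm_residual_le
    (hr : IsTsengRun F B C lam α β x0 x w wt wp y v)
    (hF : LipschitzOnWith K F C) (hC : Convex ℝ C) (hBC : opDom B ⊆ C) (hlam : 0 < lam)
    (hlamK : lam * K ≤ 1) {M : ℝ} {k : ℕ}
    (hM : ∑ i ∈ Finset.range (k + 1), ‖wt i - x (i + 1)‖ ^ 2 ≤ M) :
    ∃ j ≤ k, lam * ‖v j‖ ≤ 2 * (√M / √((k : ℝ) + 1)) := by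
  obtain ⟨j, hjk, hj⟩ := exists_le_of_sum_sq_le hM
  refine ⟨j, hjk, (mul_norm_le_of_mem_halfSpace hlam.le (pow_le_one₀ (by positivity) hlamK)
    (hr.norm_smul_residual_sub_le hF hC hBC hlam j) (hr.mem_halfSpace_inter j).1).trans ?_⟩
  gcongr

end Run

theorem le_div_one_sub_sq_mul {L σ d r κ n : ℝ} (hL : 0 < L) (hσ0 : 0 < σ) (hσ1 : σ < 1)
    (hd : 0 ≤ d) (hr : 0 ≤ r) (hκ : 0 ≤ κ) (h : σ / L * n ≤ 2 * (d * κ / r)) :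
    n ≤ 2 * d * L / r * (κ / ((1 - σ ^ 2) * σ)) := by
  have hσ : 0 < 1 - σ ^ 2 := sub_pos.2 (pow_lt_one₀ hσ0.le hσ1 two_ne_zero)
  have hn : n ≤ L / σ * (2 * (d * κ / r)) := by
    rwa [← inv_div, ← div_eq_inv_mul, le_div_iff₀' (div_pos hσ0 hL)]
  calc n ≤ 2 * d * L / r * (κ / (1 * σ)) := hn.trans_eq (by ring)
    _ ≤ 2 * d * L / r * (κ / ((1 - σ ^ 2) * σ)) := by
        gcongr
        exact sub_le_self _ (sq_nonneg σ)

end InertialTseng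

theorem theorem5p1 {H : Type*} [NormedAddCommGroup H] [InnerProductSpace ℝ H] [CompleteSpace H]
    (F : H → H) (D C : Set H) (B : H → Set H) (L σ : ℝ) (α β : ℕ → ℝ) (x0 : H)
    (hFcont : ContinuousOn F D)
    (hFmono : ∀ x ∈ D, ∀ y ∈ D, 0 ≤ inner ℝ (x - y) (F x - F y))
    (hL : 0 < L) (hFlip : ∀ x ∈ D, ∀ y ∈ D, ‖F x - F y‖ ≤ L * ‖x - y‖)
    (hB : IsMaximalMonotoneOp B)
    (hCne : C.Nonempty) (hCcl : IsClosed C) (hCconv : Convex ℝ C)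
    (hBC : opDom B ⊆ C) (hCD : C ⊆ D)
    (hS : (solSet F D B).Nonempty)
    (hσ0 : 0 < σ) (hσ1 : σ < 1)
    (hα : ∀ k, 0 ≤ α k) (hαbdd : BddAbove (Set.range α))
    (hβ : ∀ k, 0 ≤ β k) (hβsum : Summable fun k => β k ^ 2) :
    -- the projection of `x0` onto the solution set and the iterations are well defined
    ∃ xs, IsProj (solSet F D B) x0 xs ∧
      (∃ x w wt wp y v : ℕ → H, IsTsengRun F B C (σ / L) α β x0 x w wt wp y v) ∧
      ∀ x w wt wp y v : ℕ → H, IsTsengRun F B C (σ / L) α β x0 x w wt wp y v →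
        Filter.Tendsto x Filter.atTop (nhds xs) ∧
        Filter.Tendsto y Filter.atTop (nhds xs) ∧
        ∀ k : ℕ, ∃ j ≤ k,
          v j ∈ opAdd (ofMap F D) B (y j) ∧
          ‖v j‖ ≤ 2 * Metric.infDist x0 (solSet F D B) * L / √((k : ℝ) + 1) *
            (√((1 + ⨆ i, α i) *
                ((1 + ⨆ i, β i) * (1 + (⨆ i, α i) * (1 + ⨆ i, β i)) + ∑' i, β i ^ 2)) /
              ((1 - σ ^ 2) * σ)) := by
  lift L to NNReal using hL.le
  have hlam : 0 < σ / L := div_pos hσ0 hL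
  have hlamL : σ / L * L = σ := div_mul_cancel₀ σ hL.ne'
  have hmono := isMonotoneOp_ofMap_iff.2 hFmono
  have hlip : LipschitzOnWith L F C :=
    (lipschitzOnWith_iff_norm_sub_le.2 fun x hx y hy => hFlip x hx y hy).mono hCD
  have hBD := hBC.trans hCD
  have hFB := hB.opAdd_ofMap hmono hlip hCcl hBC hCD
  obtain ⟨xs, hxs⟩ := exists_isProj hS (hFB.isClosed_opInv 0) (hFB.convex_opInv 0) x0
  refine ⟨xs, hxs, exists_isTsengRun hB hFB.1 hBD hCne hCcl hCconv hS hlam α β x0, ?_⟩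
  intro x w wt wp y v hr
  have hv := hr.residual_mem hlam.ne' hBD
  have hd := hr.norm_sub_le_of_mem_opInv_zero hFB.1 hv hxs.mem
  have hM := hr.sum_norm_wt_sub_succ_sq_le hd hα (le_ciSup hαbdd) hβ
    (le_ciSup (bddAbove_range_of_summable_sq hβsum)) hβsum
  obtain ⟨hx, hy⟩ := hr.tendsto hFB hv hxs hlip hCconv hBC hlam (hlamL.trans_lt hσ1) hM
  refine ⟨hx, hy, fun k => ?_⟩
  obtain ⟨j, hjk, hj⟩ := hr.exists_mul_norm_residual_le hlip hCconv hBC hlam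
    (hlamL.trans_le hσ1.le) (hM (k + 1))
  rw [Real.sqrt_mul (sq_nonneg _), Real.sqrt_sq (norm_nonneg _), ← hxs.infDist_eq] at hj
  exact ⟨j, hjk, hv j, le_div_one_sub_sq_mul hL hσ0 hσ1 Metric.infDist_nonneg
    (Real.sqrt_nonneg _) (Real.sqrt_nonneg _) hj⟩
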